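/- Let $H$ be a complex Hilbert space, $\mathfrak A=\mathcal B(H)$ the $C^*$-algebra of bounded operators on $H$, and $\mathfrak k=\mathcal K(H)$ the closed two-sided ideal of compact operators. Let $G=\mathfrak A^\times$ be the real Banach--Lie group of invertible elements, with Lie algebra $\mathfrak A$, and let $K=G\cap(\mathbb 1+\mathfrak k)$. The quotient $G/K$ carries the quotient topology and the Banach manifold structure modelled on $\mathfrak A/\mathfrak k$ for which the injection $aK\mapsto a+\mathfrak k$ into $\mathfrak A/\mathfrak k$ is a global chart; the quotient map $\pi:G\to G/K$ is then smooth with surjective differentials. Write $p_0=\pi(\mathbb 1)$ and $\alpha_g(aK)=gaK$. Let $\ell:\mathfrak A\to\mathbb C$ be a bounded linear functional with $\ell|_{\mathfrak k}=0$ and $\ell(\mathbb 1)=1$ (such $\ell$ exist exactly when $H$ is infinite-dimensional), let $n\in\mathfrak A\setminus\mathfrak k$, and assume $\ell(n)\neq 0$. Put $N(a)=\ell(a)\,n$ for $a\in\mathfrak A$. Then: 1. $N$ is admissible: $N\mathfrak k\subset\mathfrak k$, and $kN(a)k^{-1}-N(kak^{-1})\in\mathfrak k$ for all $k\in K$ and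 $a\in\mathfrak A$. 2. $N$ induces a vector bundle map on $T(G/K)$: there is exactly one smooth vector bundle map $\mathcal N:T(G/K)\to T(G/K)$ covering the identity such that $\mathcal N_{p_0}\pi_{*1}v=\pi_{*1}Nv$ for all $v\in\mathfrak A$ and $\mathcal N_{\alpha_g(p_0)}=(\alpha_g)_*\,\mathcal N_{p_0}\,(\alpha_g)_*^{-1}$ for all $g\in G$. It is homogeneous, i.e. $(\alpha_g)_*\mathcal N_p=\mathcal N_{\alpha_g(p)}(\alpha_g)_*$ for all $g\in G$ and $p\in G/K$. 3. $\mathcal N$ is not a Nijenhuis operator, i.e. its Nijenhuis torsion $$\Omega_{\mathcal N}(X,Y)=\mathcal N[\mathcal NX,Y]+\mathcal N[X,\mathcal NY]-[\mathcal NX,\mathcal NY]-\mathcal N^2[X,Y]$$ does not vanish for all smooth vector fields $X,Y$ on $G/K$. -/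

import Mathlib

open Topology
open scoped Manifold ContDiff

/-! ## Nijenhuis torsion of a vector bundle map on a smooth Banach manifold -/

section Manifolds

variable {E : Type*} [NormedAddCommGroup E] [NormedSpace ℝ E]
  {H : Type*} [TopologicalSpace H] (I : ModelWithCorners ℝ E H)
  (M : Type*) [TopologicalSpace M] [ChartedSpace H M] [IsManifold I ∞ M]

/-- A smooth vector bundle map `T M → T M` covering the identity: a bounded real-linear operator on
each fibre, such that the induced map on the total space is smooth. -/
structure SmoothBundleMap where
  /-- The operator on the fibre over `p`. -/
  fiber : ∀ p : M, TangentSpace I p →L[ℝ] TangentSpace I p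
  smooth : ContMDiff I.tangent I.tangent ∞
    (fun x : TangentBundle I M => (⟨x.1, fiber x.1 x.2⟩ : TangentBundle I M))

variable {M}

/-- Smoothness of a vector field, as a section of the tangent bundle. -/
def IsSmoothVectorField (X : ∀ p : M, TangentSpace I p) : Prop :=
  ContMDiff I I.tangent ∞ (fun p : M => (⟨p, X p⟩ : TangentBundle I M))

variable {I}

/-- The Nijenhuis torsion
`Ω(X, Y) = 𝒩[𝒩X, Y] + 𝒩[X, 𝒩Y] - [𝒩X, 𝒩Y] - 𝒩²[X, Y]`. -/
noncomputable def SmoothBundleMap.torsion (𝒩 : SmoothBundleMap I M)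
    (X Y : ∀ p : M, TangentSpace I p) (p : M) : TangentSpace I p :=
  𝒩.fiber p (VectorField.mlieBracket I (fun q => 𝒩.fiber q (X q)) Y p)
    + 𝒩.fiber p (VectorField.mlieBracket I X (fun q => 𝒩.fiber q (Y q)) p)
    - VectorField.mlieBracket I (fun q => 𝒩.fiber q (X q)) (fun q => 𝒩.fiber q (Y q)) p
    - 𝒩.fiber p (𝒩.fiber p (VectorField.mlieBracket I X Y p))

/-- `𝒩` is a Nijenhuis operator: its torsion vanishes on all smooth vector fields. -/
def SmoothBundleMap.IsNijenhuis (𝒩 : SmoothBundleMap I M) : Prop :=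
  ∀ X Y : ∀ p : M, TangentSpace I p, IsSmoothVectorField I X → IsSmoothVectorField I Y →
    ∀ p : M, 𝒩.torsion X Y p = 0

end Manifolds

/-! ## The homogeneous space `G/K` of a closed two-sided ideal -/

section HomogeneousSpace

variable {A : Type*} [CStarAlgebra A] (𝔨 : Ideal A) [𝔨.IsTwoSided]

/-- `K = (1 + 𝔨)ˣ`, the invertible elements that differ from `1` by an element of `𝔨`. -/
def unitsOneAdd : Subgroup Aˣ where
  carrier := {g | (g : A) - 1 ∈ 𝔨}
  one_mem' := by simp
  mul_mem' {a b} ha hb := by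
    have h := 𝔨.add_mem (𝔨.mul_mem_left (a : A) hb) ha
    have e : (a : A) * ((b : A) - 1) + ((a : A) - 1) = ((a * b : Aˣ) : A) - 1 := by
      push_cast; noncomm_ring
    rw [e] at h
    exact h
  inv_mem' {a} ha := by
    have h := 𝔨.neg_mem (𝔨.mul_mem_left ((a⁻¹ : Aˣ) : A) ha)
    have e : -(((a⁻¹ : Aˣ) : A) * ((a : A) - 1)) = ((a⁻¹ : Aˣ) : A) - 1 := by
      rw [mul_sub, Units.inv_mul]; noncomm_ring
    rw [e] at h
    exact h

theorem mem_unitsOneAdd {g : Aˣ} : g ∈ unitsOneAdd 𝔨 ↔ (g : A) - 1 ∈ 𝔨 := Iff.rfl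

/-- The homogeneous space `G/K` with `G = Aˣ` and `K = (1 + 𝔨)ˣ`; it carries the quotient topology
and the left action `α` of `G`. -/
abbrev HomSpace : Type _ := Aˣ ⧸ unitsOneAdd 𝔨

/-- The quotient map `π : G → G/K`. -/
def quotMap (g : Aˣ) : HomSpace 𝔨 := (g : Aˣ ⧸ unitsOneAdd 𝔨)

/-- The base point `p₀ = π(1)`. -/
def basePoint : HomSpace 𝔨 := quotMap 𝔨 1

theorem quotMap_eq_iff {a b : Aˣ} :
    quotMap 𝔨 a = quotMap 𝔨 b ↔ (a : A) - (b : A) ∈ 𝔨 := by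
  have h0 : quotMap 𝔨 a = quotMap 𝔨 b ↔ a⁻¹ * b ∈ unitsOneAdd 𝔨 := QuotientGroup.eq
  rw [h0, mem_unitsOneAdd]
  constructor
  · intro h
    have h1 := 𝔨.neg_mem (𝔨.mul_mem_left (a : A) h)
    have e : -((a : A) * (((a⁻¹ * b : Aˣ) : A) - 1)) = (a : A) - (b : A) := by
      push_cast; rw [mul_sub, Units.mul_inv_cancel_left]; noncomm_ring
    rwa [e] at h1
  · intro h
    have h1 := 𝔨.neg_mem (𝔨.mul_mem_left ((a⁻¹ : Aˣ) : A) h)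
    have e : -(((a⁻¹ : Aˣ) : A) * ((a : A) - (b : A))) = ((a⁻¹ * b : Aˣ) : A) - 1 := by
      push_cast; rw [mul_sub, Units.inv_mul]; noncomm_ring
    rwa [e] at h1

/-- The injection `ι : G/K → A/𝔨`, `aK ↦ a + 𝔨`. -/
def homSpaceEmb : HomSpace 𝔨 → A ⧸ 𝔨 :=
  Quotient.lift (fun a : Aˣ => (Submodule.Quotient.mk (a : A) : A ⧸ 𝔨)) (by
    intro a b hab
    have h : quotMap 𝔨 a = quotMap 𝔨 b := Quotient.sound hab
    exact (Submodule.Quotient.eq 𝔨).2 ((quotMap_eq_iff 𝔨).1 h))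

theorem homSpaceEmb_quotMap (a : Aˣ) :
    homSpaceEmb 𝔨 (quotMap 𝔨 a) = Submodule.Quotient.mk (a : A) := rfl

theorem homSpaceEmb_isOpenEmbedding : IsOpenEmbedding (homSpaceEmb 𝔨) := by
  have hcont : Continuous (fun a : A => (Submodule.Quotient.mk a : A ⧸ 𝔨)) :=
    continuous_quot_mk
  have hopen : IsOpenMap (fun a : A => (Submodule.Quotient.mk a : A ⧸ 𝔨)) :=
    𝔨.isOpenMap_mkQ
  refine IsOpenEmbedding.of_continuous_injective_isOpenMap ?_ ?_ ?_
  · exact (hcont.comp Units.continuous_val).quotient_lift _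
  · intro x y
    induction x using Quotient.inductionOn with | _ a =>
    induction y using Quotient.inductionOn with | _ b =>
    intro h
    exact (quotMap_eq_iff 𝔨).2 ((Submodule.Quotient.eq 𝔨).1 h)
  · intro U hU
    have hU' : IsOpen (quotMap 𝔨 ⁻¹' U) := hU.preimage continuous_quot_mk
    have e : homSpaceEmb 𝔨 '' U =
        (fun a : A => (Submodule.Quotient.mk a : A ⧸ 𝔨)) ''
          ((fun u : Aˣ => (u : A)) '' (quotMap 𝔨 ⁻¹' U)) := by
      rw [Set.image_image]
      ext y
      constructor
      · rintro ⟨x, hx, rfl⟩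
        induction x using Quotient.inductionOn with | _ a => exact ⟨a, hx, rfl⟩
      · rintro ⟨a, ha, rfl⟩
        exact ⟨quotMap 𝔨 a, ha, rfl⟩
    rw [e]
    exact hopen _ (Units.isOpenEmbedding_val.isOpenMap _ hU')

variable [IsClosed (𝔨 : Set A)]

instance homSpaceNonempty : Nonempty (HomSpace 𝔨) := ⟨basePoint 𝔨⟩

/-- The Banach manifold structure of `G/K`, modelled on `A/𝔨`, with `ι` as a global chart. -/
noncomputable instance homSpaceChartedSpace : ChartedSpace (A ⧸ 𝔨) (HomSpace 𝔨) :=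
  (homSpaceEmb_isOpenEmbedding 𝔨).singletonChartedSpace

instance homSpaceIsManifold : IsManifold 𝓘(ℝ, A ⧸ 𝔨) ∞ (HomSpace 𝔨) :=
  (homSpaceEmb_isOpenEmbedding 𝔨).isManifold_singleton

instance homSpaceT2 : T2Space (HomSpace 𝔨) :=
  (homSpaceEmb_isOpenEmbedding 𝔨).isEmbedding.t2Space

/-- `π` is smooth. -/
theorem contMDiff_quotMap : ContMDiff 𝓘(ℝ, A) 𝓘(ℝ, A ⧸ 𝔨) ∞ (quotMap 𝔨) := by
  apply ContMDiff.of_comp_isOpenEmbedding (homSpaceEmb_isOpenEmbedding 𝔨)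
  have h : ContMDiff 𝓘(ℝ, A) 𝓘(ℝ, A ⧸ 𝔨) ∞ (𝔨.mkQL.restrictScalars ℝ) :=
    (𝔨.mkQL.restrictScalars ℝ).contDiff.contMDiff
  exact h.comp Units.contMDiff_val

/-- The differential of `π` at every point of `G ⊆ A` is the linear quotient map `A → A/𝔨`. -/
theorem hasMFDerivAt_quotMap (g : Aˣ) :
    HasMFDerivAt 𝓘(ℝ, A) 𝓘(ℝ, A ⧸ 𝔨) (quotMap 𝔨) g (𝔨.mkQL.restrictScalars ℝ : A →L[ℝ] A ⧸ 𝔨) := by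
  refine ⟨(contMDiff_quotMap 𝔨).continuous.continuousAt, ?_⟩
  have hc : ∀ u : Aˣ, (extChartAt 𝓘(ℝ, A) g) u = (u : A) := fun u => by
    simp
  have h1 : HasFDerivAt (𝔨.mkQL.restrictScalars ℝ : A → A ⧸ 𝔨)
    (𝔨.mkQL.restrictScalars ℝ : A →L[ℝ] A ⧸ 𝔨) ((extChartAt 𝓘(ℝ, A) g) g) :=
    (𝔨.mkQL.restrictScalars ℝ).hasFDerivAt
  refine (h1.congr_of_eventuallyEq ?_).hasFDerivWithinAt
  have hm := extChartAt_target_mem_nhds (I := 𝓘(ℝ, A)) g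
  filter_upwards [hm] with y hy
  have h2 := (extChartAt 𝓘(ℝ, A) g).right_inv hy
  rw [hc] at h2
  change homSpaceEmb 𝔨 (quotMap 𝔨 ((extChartAt 𝓘(ℝ, A) g).symm y)) = _
  rw [homSpaceEmb_quotMap, h2]
  rfl

/-- The differential `π_{*1} : A = T_1 G → T_{p₀}(G/K)`. -/
noncomputable def quotDeriv :
    TangentSpace 𝓘(ℝ, A) (1 : Aˣ) →L[ℝ] TangentSpace 𝓘(ℝ, A ⧸ 𝔨) (basePoint 𝔨) :=
  mfderiv 𝓘(ℝ, A) 𝓘(ℝ, A ⧸ 𝔨) (quotMap 𝔨) (1 : Aˣ)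

theorem quotDeriv_apply (v : A) : quotDeriv 𝔨 v = (Submodule.Quotient.mk v : A ⧸ 𝔨) := by
  unfold quotDeriv
  erw [(hasMFDerivAt_quotMap 𝔨 1).mfderiv]
  rfl

theorem quotDeriv_surjective : Function.Surjective (quotDeriv 𝔨) := fun x => by
  obtain ⟨v, rfl⟩ := Submodule.Quotient.mk_surjective 𝔨 x
  exact ⟨v, quotDeriv_apply 𝔨 v⟩

/-- The differential `(α_g)_*` at `p` of the action `α_g : G/K → G/K`, `aK ↦ gaK`. -/
noncomputable def actDeriv (g : Aˣ) (p : HomSpace 𝔨) :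
    TangentSpace 𝓘(ℝ, A ⧸ 𝔨) p →L[ℝ] TangentSpace 𝓘(ℝ, A ⧸ 𝔨) (g • p) :=
  mfderiv 𝓘(ℝ, A ⧸ 𝔨) 𝓘(ℝ, A ⧸ 𝔨) (fun q : HomSpace 𝔨 => g • q) p

/-- Smooth vector bundle maps `T(G/K) → T(G/K)` covering the identity. -/
abbrev HomBundleMap : Type _ := SmoothBundleMap 𝓘(ℝ, A ⧸ 𝔨) (HomSpace 𝔨)

/-- `𝒩` is homogeneous: `(α_g)_* 𝒩_p = 𝒩_{α_g(p)} (α_g)_*`. -/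
def IsHomogeneousMap (𝒩 : HomBundleMap 𝔨) : Prop :=
  ∀ (g : Aˣ) (p : HomSpace 𝔨) (x : TangentSpace 𝓘(ℝ, A ⧸ 𝔨) p),
    actDeriv 𝔨 g p (𝒩.fiber p x) = 𝒩.fiber (g • p) (actDeriv 𝔨 g p x)

/-- `N` induces `𝒩`: `𝒩_{p₀} π_{*1} v = π_{*1} N v`, and `𝒩_p = (α_g)_* 𝒩_{p₀} (α_g)_*⁻¹` for
`p = g • p₀`. -/
structure Induces (N : A →L[ℝ] A) (𝒩 : HomBundleMap 𝔨) : Prop where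
  base : ∀ v : A, 𝒩.fiber (basePoint 𝔨) (quotDeriv 𝔨 v) = quotDeriv 𝔨 (N v)
  transport : ∀ (g : Aˣ) (x : TangentSpace 𝓘(ℝ, A ⧸ 𝔨) (basePoint 𝔨)),
    𝒩.fiber (g • basePoint 𝔨) (actDeriv 𝔨 g (basePoint 𝔨) x) =
      actDeriv 𝔨 g (basePoint 𝔨) (𝒩.fiber (basePoint 𝔨) x)

/-- Admissible operators: `N 𝔨 ⊆ 𝔨`, and `Ran (Ad_k N - N Ad_k) ⊆ 𝔨` for all `k ∈ K`. -/
structure IsAdmissible (N : A →L[ℝ] A) : Prop where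
  map_mem : ∀ a ∈ 𝔨, N a ∈ 𝔨
  comm_mem : ∀ k ∈ unitsOneAdd 𝔨, ∀ a : A,
    (k : A) * N a * ((k⁻¹ : Aˣ) : A) - N ((k : A) * a * ((k⁻¹ : Aˣ) : A)) ∈ 𝔨

end HomogeneousSpace

/-! ## Rank one operators -/

/-- The operator `N(a) = ℓ(a) n`, as an operator on the real Banach space underlying `A`. -/
noncomputable def rankOneOp {A : Type*} [CStarAlgebra A] (ℓ : A →L[ℂ] ℂ) (n : A) : A →L[ℝ] A :=
  (ℓ.smulRight n).restrictScalars ℝ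

/-! ## Compact operators -/

/-- The ideal `𝒦(H)` of compact operators in `ℬ(H)`. -/
def compactIdeal (H : Type*) [NormedAddCommGroup H] [InnerProductSpace ℂ H] :
    Ideal (H →L[ℂ] H) where
  carrier := {T | IsCompactOperator T}
  add_mem' hS hT := hS.add hT
  zero_mem' := isCompactOperator_zero
  smul_mem' S _ hT := hT.clm_comp S

instance compactIdeal_isTwoSided (H : Type*) [NormedAddCommGroup H] [InnerProductSpace ℂ H] :
    (compactIdeal H).IsTwoSided :=
  ⟨fun {_} S hT => IsCompactOperator.comp_clm hT S⟩

instance compactIdeal_isClosed (H : Type*) [NormedAddCommGroup H] [InnerProductSpace ℂ H]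
    [CompleteSpace H] : IsClosed (compactIdeal H : Set (H →L[ℂ] H)) :=
  isClosed_setOfPred_isCompactOperator

/-! ### Conjugation along a linear family of operators -/

section Conjugation

variable {E F : Type*} [NormedAddCommGroup E] [NormedSpace ℝ E] [NormedAddCommGroup F]
  [NormedSpace ℝ F] [CompleteSpace F] (L : E →L[ℝ] F →L[ℝ] F) (T : F →L[ℝ] F)

/-! The chart `homSpaceEmb` trivialises the tangent bundle, and `g` acts on it as left
multiplication by its class in `A ⧸ 𝔨`. If `T` is the operator on `A ⧸ 𝔨` induced by `N`,
homogeneity forces the fibre over `q` to be `L_q T L_q⁻¹`, with `L_q` left multiplication by `q`.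
This formula gives a smooth homogeneous bundle map, and transitivity gives uniqueness.

On constant fields `x`, `y` the torsion at the base point needs only the derivative of `q ↦ L_q T
L_q⁻¹ x` at `1`. It becomes the algebraic expression `T[Tx,y] + T[x,Ty] - [Tx,Ty] - T²[x,y]` in
commutators of `A ⧸ 𝔨` (`torsion_conjBundleMap_const`).

For `N a = ℓ a • n` the third term vanishes. If the torsion is zero, applying `ℓ` and cancelling `ℓ
n` gives `ℓ a ℓ[n,b] + ℓ b ℓ[a,n] = ℓ[a,b] ℓ n`. Taking `a = 1` gives `ℓ[n,b] = 0` for all `b`,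
hence `ℓ[a,b] = 0`: `ℓ` is a trace. But on an infinite-dimensional `H` the identity splits as `SS* +
RR*` with `S`, `R` isometries, so a trace satisfies `ℓ 1 = 2 ℓ 1`, contradicting `ℓ 1 = 1`. -/

theorem contDiffAt_conj_ringInverse {q : E} (hq : IsUnit (L q)) :
    ContDiffAt ℝ ∞ (fun q => L q * T * Ring.inverse (L q)) q := by
  have h1 : ContDiffAt ℝ ∞ L q := L.contDiff.contDiffAt
  obtain ⟨u, hu⟩ := hq
  have h0 : ContDiffAt ℝ ∞ Ring.inverse (L q) := hu ▸ contDiffAt_ringInverse ℝ u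
  have h2 : ContDiffAt ℝ ∞ (fun q => Ring.inverse (L q)) q := h0.comp q h1
  exact (h1.mul contDiffAt_const).mul h2

/-- Inversion has derivative `-id` at `1`, so the product rule leaves `y ↦ L y (T x) - T (L y x)`.
-/
theorem hasFDerivAt_conj_ringInverse_apply {q : E} (hq : L q = 1) (x : F) :
    HasFDerivAt (fun q => (L q * T * Ring.inverse (L q)) x)
      (L.flip (T x) - T ∘L L.flip x) q := by
  have h1 : HasFDerivAt L L q := L.hasFDerivAt
  have h0 := hasFDerivAt_ringInverse (𝕜 := ℝ) (R := F →L[ℝ] F) 1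
  rw [Units.val_one, ← hq] at h0
  have h2 : HasFDerivAt (fun q => Ring.inverse (L q)) _ q := h0.comp q h1
  have h3 : HasFDerivAt (fun q => Ring.inverse (L q) x) _ q :=
    h2.clm_apply (hasFDerivAt_const x q)
  have h4 : HasFDerivAt (fun q => T (Ring.inverse (L q) x)) _ q := T.hasFDerivAt.comp q h3
  have h5 : HasFDerivAt (fun q => L q (T (Ring.inverse (L q) x))) _ q := h1.clm_apply h4
  refine h5.congr_fderiv ?_
  ext y
  simp [hq]
  abel

end Conjugation

/-! ### Operators on the quotient by the ideal -/

section QuotientOperators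

variable {A : Type*} [CStarAlgebra A] (𝔨 : Ideal A)

/-- The real bounded operator on `A/𝔨` induced by an operator on `A` that preserves `𝔨`. -/
noncomputable def quotientOperator (N : A →L[ℝ] A) (hN : ∀ a ∈ 𝔨, N a ∈ 𝔨) :
    (A ⧸ 𝔨) →L[ℝ] (A ⧸ 𝔨) where
  toFun := Quotient.lift (fun a : A => (Submodule.Quotient.mk (N a) : A ⧸ 𝔨)) (by
    intro a b hab
    have h : a - b ∈ 𝔨 := (Submodule.quotientRel_def 𝔨).1 hab
    refine (Submodule.Quotient.eq 𝔨).2 ?_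
    rw [← map_sub]
    exact hN _ h)
  map_add' x y := by
    obtain ⟨a, rfl⟩ := Submodule.Quotient.mk_surjective 𝔨 x
    obtain ⟨b, rfl⟩ := Submodule.Quotient.mk_surjective 𝔨 y
    exact congrArg Submodule.Quotient.mk (map_add N a b)
  map_smul' c x := by
    obtain ⟨a, rfl⟩ := Submodule.Quotient.mk_surjective 𝔨 x
    exact congrArg Submodule.Quotient.mk (map_smul N c a)
  cont := by
    have h : Continuous (fun a : A => (Submodule.Quotient.mk (N a) : A ⧸ 𝔨)) :=
      𝔨.mkQL.continuous.comp N.continuous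
    exact h.quotient_lift _

variable [𝔨.IsTwoSided]

theorem Ideal.Quotient.norm_mul_le_of_isTwoSided (x y : A ⧸ 𝔨) : ‖x * y‖ ≤ ‖x‖ * ‖y‖ := by
  -- The quotient norm is an infimum over representatives, so choose near-optimal ones and let `ε`
  -- tend to `0`.
  have key : ∀ ε > 0, ‖x * y‖ ≤ (‖x‖ + ε) * (‖y‖ + ε) := by
    intro ε hε
    obtain ⟨a, rfl, ha⟩ := Submodule.Quotient.norm_mk_lt x hε
    obtain ⟨b, rfl, hb⟩ := Submodule.Quotient.norm_mk_lt y hε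
    calc _ ≤ ‖a * b‖ := Submodule.Quotient.norm_mk_le (S := 𝔨) (a * b)
      _ ≤ ‖a‖ * ‖b‖ := norm_mul_le a b
      _ ≤ _ := mul_le_mul ha.le hb.le (norm_nonneg _) (by positivity)
  have hlim : Filter.Tendsto (fun ε : ℝ => (‖x‖ + ε) * (‖y‖ + ε)) (𝓝[>] 0) (𝓝 (‖x‖ * ‖y‖)) := by
    have h : Continuous (fun ε : ℝ => (‖x‖ + ε) * (‖y‖ + ε)) := by fun_prop
    simpa using (h.tendsto 0).mono_left nhdsWithin_le_nhds
  exact ge_of_tendsto hlim (eventually_mem_nhdsWithin.mono key)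

/-- Left multiplication in `A/𝔨`, as a real bounded bilinear map. -/
noncomputable def quotientMul : (A ⧸ 𝔨) →L[ℝ] (A ⧸ 𝔨) →L[ℝ] (A ⧸ 𝔨) :=
  LinearMap.mkContinuous₂
    (LinearMap.mk₂ ℝ (fun x y : A ⧸ 𝔨 => x * y) add_mul
      (fun c x y => by
        obtain ⟨a, rfl⟩ := Submodule.Quotient.mk_surjective 𝔨 x
        obtain ⟨b, rfl⟩ := Submodule.Quotient.mk_surjective 𝔨 y
        exact congrArg (Submodule.Quotient.mk (p := 𝔨)) (smul_mul_assoc c a b))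
      mul_add
      (fun c x y => by
        obtain ⟨a, rfl⟩ := Submodule.Quotient.mk_surjective 𝔨 x
        obtain ⟨b, rfl⟩ := Submodule.Quotient.mk_surjective 𝔨 y
        exact congrArg (Submodule.Quotient.mk (p := 𝔨)) (mul_smul_comm c a b)))
    1 (fun x y => by simpa using Ideal.Quotient.norm_mul_le_of_isTwoSided 𝔨 x y)

theorem quotientMul_mk_mul (a b : A) :
    quotientMul 𝔨 (Submodule.Quotient.mk (a * b)) =
      quotientMul 𝔨 (Submodule.Quotient.mk a) * quotientMul 𝔨 (Submodule.Quotient.mk b) := by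
  ext x
  obtain ⟨c, rfl⟩ := Submodule.Quotient.mk_surjective 𝔨 x
  exact congrArg Submodule.Quotient.mk (mul_assoc a b c)

theorem quotientMul_mk_one : quotientMul 𝔨 (Submodule.Quotient.mk 1) = 1 := by
  ext x
  obtain ⟨c, rfl⟩ := Submodule.Quotient.mk_surjective 𝔨 x
  exact congrArg Submodule.Quotient.mk (one_mul c)

/-- Left multiplication by an invertible element, as a unit of the operators on `A/𝔨`. -/
noncomputable def quotientMulUnit : Aˣ →* ((A ⧸ 𝔨) →L[ℝ] (A ⧸ 𝔨))ˣ :=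
  Units.map
    { toFun := fun a => quotientMul 𝔨 (Submodule.Quotient.mk a)
      map_one' := quotientMul_mk_one 𝔨
      map_mul' := quotientMul_mk_mul 𝔨 }

@[simp] theorem quotientMulUnit_val (g : Aˣ) :
    (quotientMulUnit 𝔨 g : (A ⧸ 𝔨) →L[ℝ] (A ⧸ 𝔨)) =
      quotientMul 𝔨 (Submodule.Quotient.mk (g : A)) := rfl

/-- The operator `x ↦ q T(q⁻¹ x)` on `A/𝔨`. -/
noncomputable def conjFibre (T : (A ⧸ 𝔨) →L[ℝ] (A ⧸ 𝔨)) (q : A ⧸ 𝔨) :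
    (A ⧸ 𝔨) →L[ℝ] (A ⧸ 𝔨) :=
  quotientMul 𝔨 q * T * Ring.inverse (quotientMul 𝔨 q)

theorem conjFibre_mk_unit (T : (A ⧸ 𝔨) →L[ℝ] (A ⧸ 𝔨)) (g : Aˣ) :
    conjFibre 𝔨 T (Submodule.Quotient.mk (g : A)) =
      quotientMulUnit 𝔨 g * T * ((quotientMulUnit 𝔨 g)⁻¹ : ((A ⧸ 𝔨) →L[ℝ] (A ⧸ 𝔨))ˣ) := by
  rw [conjFibre, ← quotientMulUnit_val, Ring.inverse_unit]

theorem conjFibre_mk_one (T : (A ⧸ 𝔨) →L[ℝ] (A ⧸ 𝔨)) :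
    conjFibre 𝔨 T (Submodule.Quotient.mk 1) = T := by
  rw [conjFibre, quotientMul_mk_one, Ring.inverse_one, one_mul, mul_one]

variable [IsClosed (𝔨 : Set A)]

theorem contDiffAt_conjFibre (T : (A ⧸ 𝔨) →L[ℝ] (A ⧸ 𝔨)) (g : Aˣ) :
    ContDiffAt ℝ ∞ (conjFibre 𝔨 T) (Submodule.Quotient.mk (g : A)) :=
  contDiffAt_conj_ringInverse (E := A ⧸ 𝔨) (F := A ⧸ 𝔨) (quotientMul 𝔨) T
    (quotientMulUnit 𝔨 g).isUnit

theorem hasFDerivAt_conjFibre_apply (T : (A ⧸ 𝔨) →L[ℝ] (A ⧸ 𝔨)) (x : A ⧸ 𝔨) :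
    HasFDerivAt (fun q => conjFibre 𝔨 T q x)
      ((quotientMul 𝔨).flip (T x) - T ∘L (quotientMul 𝔨).flip x) (Submodule.Quotient.mk 1) :=
  hasFDerivAt_conj_ringInverse_apply (E := A ⧸ 𝔨) (F := A ⧸ 𝔨) (quotientMul 𝔨) T
    (quotientMul_mk_one 𝔨) x

end QuotientOperators

/-! ### Manifolds whose preferred charts all coincide -/

section SingleChart

variable {E M : Type*} [NormedAddCommGroup E] [NormedSpace ℝ E] [TopologicalSpace M]
  [ChartedSpace E M]

theorem hasMFDerivAt_of_chartAt_comp {f : M → M} {p : M} (hf : ContinuousAt f p)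
    (T : E →L[ℝ] E) (h : ∀ q, chartAt E (f p) (f q) = T (chartAt E p q)) :
    HasMFDerivAt 𝓘(ℝ, E) 𝓘(ℝ, E) f p (T : E →L[ℝ] E) := by
  refine ⟨hf, ?_⟩
  have h1 : HasFDerivAt T T (extChartAt 𝓘(ℝ, E) p p) := T.hasFDerivAt
  refine (h1.congr_of_eventuallyEq ?_).hasFDerivWithinAt
  filter_upwards [extChartAt_target_mem_nhds (I := 𝓘(ℝ, E)) p] with y hy
  have h2 := (extChartAt 𝓘(ℝ, E) p).right_inv hy
  have h3 := h ((extChartAt 𝓘(ℝ, E) p).symm y)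
  simp only [mfld_simps] at h2
  simp only [writtenInExtChartAt, Function.comp, mfld_simps] at h3 ⊢
  rw [h3, h2]

variable [IsManifold 𝓘(ℝ, E) ∞ M]

/-- The coordinate change from a chart to itself is the identity, so fibre coordinates can be read
off directly. -/
theorem trivializationAt_snd_of_chartAt_eq {x : M} (z : TangentBundle 𝓘(ℝ, E) M)
    (h : chartAt E x = chartAt E z.proj) :
    (trivializationAt E (TangentSpace 𝓘(ℝ, E)) x z).2 = z.2 := by
  rw [TangentBundle.trivializationAt_apply, h]
  exact tangentCoordChange_self (I := 𝓘(ℝ, E)) (mem_extChartAt_source z.proj)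

theorem contMDiff_bundleMap_of_chartAt_eq (h : ∀ x y : M, chartAt E x = chartAt E y)
    {F : M → E →L[ℝ] E} (hF : ContMDiff 𝓘(ℝ, E) 𝓘(ℝ, E →L[ℝ] E) ∞ F) :
    ContMDiff 𝓘(ℝ, E).tangent 𝓘(ℝ, E).tangent ∞
      (fun x : TangentBundle 𝓘(ℝ, E) M => (⟨x.1, F x.1 x.2⟩ : TangentBundle 𝓘(ℝ, E) M)) := by
  intro z
  have hproj : ContMDiff 𝓘(ℝ, E).tangent 𝓘(ℝ, E) ∞
      (fun x : TangentBundle 𝓘(ℝ, E) M => x.1) := Bundle.contMDiff_proj _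
  have hfib : ContMDiffAt 𝓘(ℝ, E).tangent 𝓘(ℝ, E) ∞
      (fun x : TangentBundle 𝓘(ℝ, E) M => (x.2 : E)) z := by
    refine (Bundle.contMDiffAt_totalSpace.1
      (contMDiffAt_id (I := 𝓘(ℝ, E).tangent) (x := z))).2.congr_of_eventuallyEq ?_
    exact Filter.Eventually.of_forall fun x =>
      (trivializationAt_snd_of_chartAt_eq x (h _ _)).symm
  refine Bundle.contMDiffAt_totalSpace.2 ⟨hproj z, ?_⟩
  have hmain : ContMDiffAt 𝓘(ℝ, E).tangent 𝓘(ℝ, E) ∞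
      (fun x : TangentBundle 𝓘(ℝ, E) M => (F x.1 (x.2 : E) : E)) z :=
    ((hF.comp hproj) z).clm_apply hfib
  refine hmain.congr_of_eventuallyEq (Filter.Eventually.of_forall fun x => ?_)
  exact trivializationAt_snd_of_chartAt_eq (⟨x.1, F x.1 x.2⟩ : TangentBundle 𝓘(ℝ, E) M) (h _ _)

theorem isSmoothVectorField_const (h : ∀ x y : M, chartAt E x = chartAt E y) (v : E) :
    IsSmoothVectorField (M := M) 𝓘(ℝ, E) (fun _ => v) := by
  intro p
  refine Bundle.contMDiffAt_totalSpace.2 ⟨contMDiffAt_id, ?_⟩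
  refine (contMDiffAt_const (c := v)).congr_of_eventuallyEq (Filter.Eventually.of_forall fun x => ?_)
  exact trivializationAt_snd_of_chartAt_eq (⟨x, v⟩ : TangentBundle 𝓘(ℝ, E) M) (h _ _)

theorem mpullbackWithin_extChartAt_symm_of_chartAt_eq (h : ∀ x y : M, chartAt E x = chartAt E y)
    (V : ∀ p : M, TangentSpace 𝓘(ℝ, E) p) (p : M) {y : E}
    (hy : y ∈ (extChartAt 𝓘(ℝ, E) p).target) :
    VectorField.mpullbackWithin 𝓘(ℝ, E) 𝓘(ℝ, E) (extChartAt 𝓘(ℝ, E) p).symm V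
      (Set.range 𝓘(ℝ, E)) y = (V ((chartAt E p).symm y) : E) := by
  set q := (extChartAt 𝓘(ℝ, E) p).symm y with hq
  have he : extChartAt 𝓘(ℝ, E) p = extChartAt 𝓘(ℝ, E) q := by
    rw [extChartAt, extChartAt, h p q]
  have hyq : y = extChartAt 𝓘(ℝ, E) q q := by
    rw [← he, hq, (extChartAt 𝓘(ℝ, E) p).right_inv hy]
  rw [VectorField.mpullbackWithin_apply, ← hq, he]
  have hyV : (V ((chartAt E p).symm y) : E) = V q := rfl
  rw [hyV, hyq]
  exact mfderivWithin_extChartAt_symm_inverse_apply (I := 𝓘(ℝ, E)) (x := q) (V q)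

/-- With a single chart, pulling a field back to `E` involves no derivative factor. -/
theorem mlieBracket_of_chartAt_eq (h : ∀ x y : M, chartAt E x = chartAt E y)
    (V W : ∀ p : M, TangentSpace 𝓘(ℝ, E) p) (p : M) :
    VectorField.mlieBracket 𝓘(ℝ, E) V W p =
      (VectorField.lieBracket ℝ (fun y => (V ((chartAt E p).symm y) : E))
        (fun y => (W ((chartAt E p).symm y) : E)) (chartAt E p p) : E) := by
  rw [← VectorField.mlieBracketWithin_univ, VectorField.mlieBracketWithin_apply,
    mfderiv_extChartAt_self]
  refine (congrFun (congrArg DFunLike.coe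
    (ContinuousLinearMap.inverse_id (R := ℝ) (M := E))) _).trans ?_
  change VectorField.lieBracketWithin ℝ (E := E) _ _ (Set.univ ∩ Set.range 𝓘(ℝ, E)) _ = _
  rw [modelWithCornersSelf_coe, Set.range_id, Set.univ_inter]
  refine Eq.trans ?_ (congrFun (VectorField.lieBracketWithin_univ (𝕜 := ℝ)) _)
  have hev : ∀ᶠ y in 𝓝 (chartAt E p p), y ∈ (extChartAt 𝓘(ℝ, E) p).target :=
    extChartAt_target_mem_nhds (I := 𝓘(ℝ, E)) p
  refine Filter.EventuallyEq.lieBracketWithin_vectorField_eq_nhds ?_ ?_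
  · filter_upwards [hev] with y hy
    have e := mpullbackWithin_extChartAt_symm_of_chartAt_eq h V p hy
    rw [modelWithCornersSelf_coe, Set.range_id] at e
    exact e
  · filter_upwards [hev] with y hy
    have e := mpullbackWithin_extChartAt_symm_of_chartAt_eq h W p hy
    rw [modelWithCornersSelf_coe, Set.range_id] at e
    exact e

theorem mlieBracket_comp_chartAt (h : ∀ x y : M, chartAt E x = chartAt E y) {p : M}
    {V W : E → E} {V' W' : E →L[ℝ] E} (hV : HasFDerivAt V V' (chartAt E p p))
    (hW : HasFDerivAt W W' (chartAt E p p)) :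
    VectorField.mlieBracket 𝓘(ℝ, E) (M := M) (fun q => V (chartAt E p q))
      (fun q => W (chartAt E p q)) p =
        (W' (V (chartAt E p p)) - V' (W (chartAt E p p)) : E) := by
  refine (mlieBracket_of_chartAt_eq h _ _ p).trans ?_
  have hev : ∀ᶠ y in 𝓝 (chartAt E p p), chartAt E p ((chartAt E p).symm y) = y :=
    Filter.mem_of_superset ((chartAt E p).open_target.mem_nhds (mem_chart_target E p))
      fun y hy => (chartAt E p).right_inv hy
  have hV2 : (fun y => V (chartAt E p ((chartAt E p).symm y))) =ᶠ[𝓝 (chartAt E p p)] V :=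
    hev.mono fun y hy => congrArg V hy
  have hW2 : (fun y => W (chartAt E p ((chartAt E p).symm y))) =ᶠ[𝓝 (chartAt E p p)] W :=
    hev.mono fun y hy => congrArg W hy
  refine (hV2.lieBracket_vectorField_eq hW2).trans ?_
  rw [VectorField.lieBracket, hV.fderiv, hW.fderiv]

end SingleChart

/-! ### The homogeneous bundle map and its torsion -/

section BundleMap

variable {A : Type*} [CStarAlgebra A] (𝔨 : Ideal A)

theorem exists_smul_basePoint (p : HomSpace 𝔨) : ∃ g : Aˣ, p = g • basePoint 𝔨 := by
  induction p using Quotient.inductionOn with | _ g =>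
  exact ⟨g, congrArg (quotMap 𝔨) (mul_one g).symm⟩

variable [𝔨.IsTwoSided]

theorem homSpaceEmb_smul (g : Aˣ) (p : HomSpace 𝔨) :
    homSpaceEmb 𝔨 (g • p) = quotientMul 𝔨 (Submodule.Quotient.mk (g : A)) (homSpaceEmb 𝔨 p) := by
  induction p using Quotient.inductionOn with | _ a => rfl

theorem conjFibre_smul (T : (A ⧸ 𝔨) →L[ℝ] (A ⧸ 𝔨)) (g : Aˣ) (p : HomSpace 𝔨) (x : A ⧸ 𝔨) :
    conjFibre 𝔨 T (homSpaceEmb 𝔨 (g • p)) (quotientMul 𝔨 (Submodule.Quotient.mk (g : A)) x) =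
      quotientMul 𝔨 (Submodule.Quotient.mk (g : A)) (conjFibre 𝔨 T (homSpaceEmb 𝔨 p) x) := by
  induction p using Quotient.inductionOn with | _ a =>
  have h : conjFibre 𝔨 T (Submodule.Quotient.mk ((g * a : Aˣ) : A)) * quotientMulUnit 𝔨 g =
      quotientMulUnit 𝔨 g * conjFibre 𝔨 T (Submodule.Quotient.mk (a : A)) := by
    rw [conjFibre_mk_unit, conjFibre_mk_unit, map_mul, mul_inv_rev]
    simp [mul_assoc, -quotientMulUnit_val]
  exact congrFun (congrArg DFunLike.coe h) x

variable [IsClosed (𝔨 : Set A)]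

theorem actDeriv_apply (g : Aˣ) (p : HomSpace 𝔨) (x : A ⧸ 𝔨) :
    actDeriv 𝔨 g p x = quotientMul 𝔨 (Submodule.Quotient.mk (g : A)) x := by
  have h := hasMFDerivAt_of_chartAt_comp (E := A ⧸ 𝔨) (f := fun q : HomSpace 𝔨 => g • q) (p := p)
    (continuous_const_smul g).continuousAt (quotientMul 𝔨 (Submodule.Quotient.mk (g : A)))
    (homSpaceEmb_smul 𝔨 g)
  unfold actDeriv
  exact congrFun (congrArg DFunLike.coe h.mfderiv) x

theorem contMDiff_conjFibre (T : (A ⧸ 𝔨) →L[ℝ] (A ⧸ 𝔨)) :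
    ContMDiff 𝓘(ℝ, A ⧸ 𝔨) 𝓘(ℝ, (A ⧸ 𝔨) →L[ℝ] (A ⧸ 𝔨)) ∞
      (fun p : HomSpace 𝔨 => conjFibre 𝔨 T (homSpaceEmb 𝔨 p)) := by
  intro p
  have h1 : ContMDiffAt 𝓘(ℝ, A ⧸ 𝔨) 𝓘(ℝ, (A ⧸ 𝔨) →L[ℝ] (A ⧸ 𝔨)) ∞ (conjFibre 𝔨 T)
      (homSpaceEmb 𝔨 p) := by
    induction p using Quotient.inductionOn with | _ g =>
    exact (contDiffAt_conjFibre 𝔨 T g).contMDiffAt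
  have h2 : ContMDiff 𝓘(ℝ, A ⧸ 𝔨) 𝓘(ℝ, A ⧸ 𝔨) ∞ (homSpaceEmb 𝔨) :=
    contMDiff_isOpenEmbedding (homSpaceEmb_isOpenEmbedding 𝔨)
  exact h1.comp p (h2 p)

/-- The bundle map `x ↦ q T(q⁻¹ x)` over the point `q` of `G/K`. -/
noncomputable def conjBundleMap (T : (A ⧸ 𝔨) →L[ℝ] (A ⧸ 𝔨)) : HomBundleMap 𝔨 where
  fiber p := conjFibre 𝔨 T (homSpaceEmb 𝔨 p)
  smooth := contMDiff_bundleMap_of_chartAt_eq (E := A ⧸ 𝔨) (M := HomSpace 𝔨)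
    (fun _ _ => rfl) (contMDiff_conjFibre 𝔨 T)

theorem isHomogeneousMap_conjBundleMap (T : (A ⧸ 𝔨) →L[ℝ] (A ⧸ 𝔨)) :
    IsHomogeneousMap 𝔨 (conjBundleMap 𝔨 T) := fun g p x =>
  (actDeriv_apply 𝔨 g p _).trans ((conjFibre_smul 𝔨 T g p x).symm.trans
    (congrArg (conjFibre 𝔨 T (homSpaceEmb 𝔨 (g • p))) (actDeriv_apply 𝔨 g p x).symm))

theorem induces_conjBundleMap (N : A →L[ℝ] A) (hN : ∀ a ∈ 𝔨, N a ∈ 𝔨) :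
    Induces 𝔨 N (conjBundleMap 𝔨 (quotientOperator 𝔨 N hN)) where
  base v := by
    have h := conjFibre_mk_one 𝔨 (quotientOperator 𝔨 N hN)
    rw [quotDeriv_apply, quotDeriv_apply]
    exact congrFun (congrArg DFunLike.coe h) (Submodule.Quotient.mk v)
  transport g x := (isHomogeneousMap_conjBundleMap 𝔨 _ g (basePoint 𝔨) x).symm

theorem actDeriv_surjective (g : Aˣ) (p : HomSpace 𝔨) :
    Function.Surjective (actDeriv 𝔨 g p) := by
  intro (x : A ⧸ 𝔨)
  refine ⟨quotientMul 𝔨 (Submodule.Quotient.mk ((g⁻¹ : Aˣ) : A)) x, ?_⟩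
  refine (actDeriv_apply 𝔨 g p _).trans ?_
  obtain ⟨a, rfl⟩ := Submodule.Quotient.mk_surjective 𝔨 x
  exact congrArg Submodule.Quotient.mk (Units.mul_inv_cancel_left g a)

/-- Every tangent vector is a translate of some `π_{*1} v`, because the action is transitive and
both differentials are onto. -/
theorem Induces.unique {N : A →L[ℝ] A} {𝒩₁ 𝒩₂ : HomBundleMap 𝔨} (h₁ : Induces 𝔨 N 𝒩₁)
    (h₂ : Induces 𝔨 N 𝒩₂) : 𝒩₁ = 𝒩₂ := by
  have key : 𝒩₁.fiber = 𝒩₂.fiber := by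
    funext p
    obtain ⟨g, rfl⟩ := exists_smul_basePoint 𝔨 p
    refine ContinuousLinearMap.ext fun x => ?_
    obtain ⟨y, rfl⟩ := actDeriv_surjective 𝔨 g (basePoint 𝔨) x
    obtain ⟨v, rfl⟩ := quotDeriv_surjective 𝔨 y
    rw [h₁.transport, h₂.transport]
    exact congrArg _ ((h₁.base v).trans (h₂.base v).symm)
  cases 𝒩₁
  cases 𝒩₂
  congr

theorem mlieBracket_comp_homSpaceEmb {V W : A ⧸ 𝔨 → A ⧸ 𝔨} {V' W' : (A ⧸ 𝔨) →L[ℝ] (A ⧸ 𝔨)}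
    (hV : HasFDerivAt V V' (Submodule.Quotient.mk 1))
    (hW : HasFDerivAt W W' (Submodule.Quotient.mk 1)) :
    VectorField.mlieBracket 𝓘(ℝ, A ⧸ 𝔨) (M := HomSpace 𝔨) (fun q => V (homSpaceEmb 𝔨 q))
      (fun q => W (homSpaceEmb 𝔨 q)) (basePoint 𝔨) =
        (W' (V (Submodule.Quotient.mk 1)) - V' (W (Submodule.Quotient.mk 1)) : A ⧸ 𝔨) :=
  mlieBracket_comp_chartAt (E := A ⧸ 𝔨) (M := HomSpace 𝔨) (p := basePoint 𝔨)
    (fun _ _ => rfl) hV hW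

theorem torsion_conjBundleMap_const (T : (A ⧸ 𝔨) →L[ℝ] (A ⧸ 𝔨)) (x y : A ⧸ 𝔨) :
    (conjBundleMap 𝔨 T).torsion (fun _ => x) (fun _ => y) (basePoint 𝔨) =
      (T (T x * y - y * T x) + T (x * T y - T y * x) - (T x * T y - T y * T x)
        - T (T (x * y - y * x)) : A ⧸ 𝔨) := by
  have hx := hasFDerivAt_conjFibre_apply 𝔨 T x
  have hy := hasFDerivAt_conjFibre_apply 𝔨 T y
  have cx := hasFDerivAt_const (𝕜 := ℝ) x (Submodule.Quotient.mk 1 : A ⧸ 𝔨)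
  have cy := hasFDerivAt_const (𝕜 := ℝ) y (Submodule.Quotient.mk 1 : A ⧸ 𝔨)
  have hT : conjFibre 𝔨 T (homSpaceEmb 𝔨 (basePoint 𝔨)) = T := conjFibre_mk_one 𝔨 T
  -- Giving brackets values in `A ⧸ 𝔨` rather than a tangent space lets them be rewritten and
  -- multiplied.
  let bracket : (HomSpace 𝔨 → A ⧸ 𝔨) → (HomSpace 𝔨 → A ⧸ 𝔨) → A ⧸ 𝔨 := fun V W =>
    VectorField.mlieBracket 𝓘(ℝ, A ⧸ 𝔨) (M := HomSpace 𝔨) V W (basePoint 𝔨)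
  have b1 : bracket (fun q => conjFibre 𝔨 T (homSpaceEmb 𝔨 q) x) (fun _ => y) = _ :=
    mlieBracket_comp_homSpaceEmb 𝔨 hx cy
  have b2 : bracket (fun _ => x) (fun q => conjFibre 𝔨 T (homSpaceEmb 𝔨 q) y) = _ :=
    mlieBracket_comp_homSpaceEmb 𝔨 cx hy
  have b3 : bracket (fun q => conjFibre 𝔨 T (homSpaceEmb 𝔨 q) x)
      (fun q => conjFibre 𝔨 T (homSpaceEmb 𝔨 q) y) = _ :=
    mlieBracket_comp_homSpaceEmb 𝔨 hx hy
  have b4 : bracket (fun _ => x) (fun _ => y) = _ := mlieBracket_comp_homSpaceEmb 𝔨 cx cy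
  have e : (conjBundleMap 𝔨 T).torsion (fun _ => x) (fun _ => y) (basePoint 𝔨) =
    (conjFibre 𝔨 T (homSpaceEmb 𝔨 (basePoint 𝔨))
        (bracket (fun q => conjFibre 𝔨 T (homSpaceEmb 𝔨 q) x) (fun _ => y))
      + conjFibre 𝔨 T (homSpaceEmb 𝔨 (basePoint 𝔨))
        (bracket (fun _ => x) (fun q => conjFibre 𝔨 T (homSpaceEmb 𝔨 q) y))
      - bracket (fun q => conjFibre 𝔨 T (homSpaceEmb 𝔨 q) x)
        (fun q => conjFibre 𝔨 T (homSpaceEmb 𝔨 q) y)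
      - conjFibre 𝔨 T (homSpaceEmb 𝔨 (basePoint 𝔨)) (conjFibre 𝔨 T (homSpaceEmb 𝔨 (basePoint 𝔨))
        (bracket (fun _ => x) (fun _ => y))) : A ⧸ 𝔨) := rfl
  refine e.trans ?_
  -- The constant fields commute; the `T²` term comes instead from the derivatives of the fibre in
  -- `b1` and `b2`.
  rw [b1, b2, b3, b4, hT]
  have hL : ∀ z w : A ⧸ 𝔨, quotientMul 𝔨 z w = z * w := fun _ _ => rfl
  simp only [conjFibre_mk_one, sub_apply, ContinuousLinearMap.comp_apply,
    ContinuousLinearMap.flip_apply, zero_apply, hL, map_sub, map_zero,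
    sub_zero, zero_sub, map_neg]
  abel

theorem mem_of_isNijenhuis (N : A →L[ℝ] A) (hN : ∀ a ∈ 𝔨, N a ∈ 𝔨)
    (h : (conjBundleMap 𝔨 (quotientOperator 𝔨 N hN)).IsNijenhuis) (a b : A) :
    N (N a * b - b * N a) + N (a * N b - N b * a) - (N a * N b - N b * N a)
      - N (N (a * b - b * a)) ∈ 𝔨 := by
  have hs := isSmoothVectorField_const (E := A ⧸ 𝔨) (M := HomSpace 𝔨) (fun _ _ => rfl)
  have h0 := h _ _ (hs (Submodule.Quotient.mk a)) (hs (Submodule.Quotient.mk b)) (basePoint 𝔨)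
  rw [torsion_conjBundleMap_const] at h0
  exact (Submodule.Quotient.mk_eq_zero 𝔨).1 h0

end BundleMap

/-! ### Traces on the bounded operators -/

section Commutators

variable {H : Type*} [NormedAddCommGroup H] [InnerProductSpace ℂ H]

theorem isCompactOperator_of_finiteDimensional [FiniteDimensional ℂ H] (T : H →L[ℂ] H) :
    IsCompactOperator T :=
  ((isCompactOperator_id_iff_finiteDimensional (𝕜 := ℂ)).2 ‹_›).clm_comp T

variable [CompleteSpace H]

/-- An injective self-map of the index set of a Hilbert basis is induced by an isometry. -/
theorem HilbertBasis.exists_linearIsometry_apply_eq {ι : Type*} (b : HilbertBasis ι ℂ H)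
    {f : ι → ι} (hf : Function.Injective f) :
    ∃ S : H →ₗᵢ[ℂ] H, ∀ i, S (b i) = b (f i) := by
  classical
  -- Coordinates map `H` onto ℓ², which the orthonormal family `b ∘ f` embeds isometrically back
  -- into `H`.
  refine ⟨(b.orthonormal.comp f hf).orthogonalFamily.linearIsometry.comp
    b.repr.toLinearIsometry, fun i => ?_⟩
  simp [b.repr_self]

open ContinuousLinearMap in
theorem exists_isometries_add_eq_one (hH : ¬ FiniteDimensional ℂ H) :
    ∃ S R : H →L[ℂ] H, adjoint S * S = 1 ∧ adjoint R * R = 1 ∧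
      S * adjoint S + R * adjoint R = 1 := by
  classical
  obtain ⟨w, b, -⟩ := exists_hilbertBasis ℂ H
  have hw : Infinite w := by
    by_contra hfin
    have := not_infinite_iff_finite.1 hfin
    have := Fintype.ofFinite w
    exact hH b.toOrthonormalBasis.toBasis.finiteDimensional_of_finite
  -- The infinite basis splits into two copies of itself, which span the ranges of `S` and `R`.
  obtain ⟨e⟩ : Nonempty (w ⊕ w ≃ w) := by
    rw [← Cardinal.eq, Cardinal.mk_sum, Cardinal.lift_id,
      Cardinal.add_eq_self (Cardinal.aleph0_le_mk w)]
  obtain ⟨S, hS⟩ := b.exists_linearIsometry_apply_eq (f := e ∘ Sum.inl)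
    (e.injective.comp Sum.inl_injective)
  obtain ⟨R, hR⟩ := b.exists_linearIsometry_apply_eq (f := e ∘ Sum.inr)
    (e.injective.comp Sum.inr_injective)
  have hSS : adjoint S.toContinuousLinearMap * S.toContinuousLinearMap = 1 :=
    (norm_map_iff_adjoint_comp_self _).1 S.norm_map
  have hRR : adjoint R.toContinuousLinearMap * R.toContinuousLinearMap = 1 :=
    (norm_map_iff_adjoint_comp_self _).1 R.norm_map
  have hext : ∀ x : H, (∀ i, inner ℂ (b i) x = 0) → x = 0 := fun x hx => by
    apply b.repr.injective
    ext i
    simp [b.repr_apply_apply, hx]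
  -- The two ranges are orthogonal because `e` separates the summands.
  have hRS : ∀ i, adjoint R.toContinuousLinearMap (S (b i)) = 0 := fun i => hext _ fun k => by
    rw [adjoint_inner_right, hS]
    change inner ℂ (R (b k)) _ = 0
    rw [hR, orthonormal_iff_ite.1 b.orthonormal]
    simp
  have hSR : ∀ i, adjoint S.toContinuousLinearMap (R (b i)) = 0 := fun i => hext _ fun k => by
    rw [adjoint_inner_right, hR]
    change inner ℂ (S (b k)) _ = 0
    rw [hS, orthonormal_iff_ite.1 b.orthonormal]
    simp
  refine ⟨S.toContinuousLinearMap, R.toContinuousLinearMap, hSS, hRR, ?_⟩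
  refine ContinuousLinearMap.ext_on (s := Set.range b) ?_ ?_
  · exact Submodule.dense_iff_topologicalClosure_eq_top.2 b.dense_span
  · rintro _ ⟨j, rfl⟩
    obtain ⟨i | i, rfl⟩ := e.surjective j
    · have h1 : adjoint S.toContinuousLinearMap (S (b i)) = b i :=
        congrFun (congrArg DFunLike.coe hSS) (b i)
      have h2 : b (e (Sum.inl i)) = S (b i) := (hS i).symm
      simp [h2, h1, hRS]
    · have h1 : adjoint R.toContinuousLinearMap (R (b i)) = b i :=
        congrFun (congrArg DFunLike.coe hRR) (b i)
      have h2 : b (e (Sum.inr i)) = R (b i) := (hR i).symm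
      simp [h2, h1, hSR]

theorem map_one_eq_zero_of_forall_map_mul_comm (hH : ¬ FiniteDimensional ℂ H)
    (ℓ : (H →L[ℂ] H) →L[ℂ] ℂ) (h : ∀ a b, ℓ (a * b) = ℓ (b * a)) : ℓ 1 = 0 := by
  obtain ⟨S, R, hS, hR, hSR⟩ := exists_isometries_add_eq_one hH
  have h1 := congrArg ℓ hSR
  rw [map_add, h, hS, h R, hR] at h1
  simpa using h1

end Commutators

/-! ### Admissibility and the contradiction -/

theorem isAdmissible_of_map_mem {A : Type*} [CStarAlgebra A] (𝔨 : Ideal A) [𝔨.IsTwoSided]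
    (N : A →L[ℝ] A) (hN : ∀ a ∈ 𝔨, N a ∈ 𝔨) : IsAdmissible 𝔨 N where
  map_mem := hN
  comm_mem k hk a := by
    -- As `k` is `1` modulo `𝔨`, conjugation by it is trivial modulo `𝔨`; this applies to `N a`, and
    -- to `a` before `N`.
    have conj_sub_mem : ∀ c : A, (k : A) * c * ((k⁻¹ : Aˣ) : A) - c ∈ 𝔨 := fun c => by
      have h1 : ((k : A) - 1) * c * ((k⁻¹ : Aˣ) : A) + c * (((k⁻¹ : Aˣ) : A) - 1) ∈ 𝔨 :=
        𝔨.add_mem (𝔨.mul_mem_right _ (𝔨.mul_mem_right _ hk))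
          (𝔨.mul_mem_left _ ((unitsOneAdd 𝔨).inv_mem hk))
      convert h1 using 1
      noncomm_ring
    have h2 := 𝔨.sub_mem (conj_sub_mem (N a)) (hN _ (conj_sub_mem a))
    rw [map_sub] at h2
    convert h2 using 1
    abel

theorem mainTheorem7 {H : Type*} [NormedAddCommGroup H] [InnerProductSpace ℂ H] [CompleteSpace H]
    (ℓ : (H →L[ℂ] H) →L[ℂ] ℂ) (hℓ : ∀ k ∈ compactIdeal H, ℓ k = 0) (hℓ_one : ℓ 1 = 1)
    (n : H →L[ℂ] H) (hn : n ∉ compactIdeal H) (hℓn : ℓ n ≠ 0) :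
    IsAdmissible (compactIdeal H) (rankOneOp ℓ n) ∧
    (∃! 𝒩 : HomBundleMap (compactIdeal H), Induces (compactIdeal H) (rankOneOp ℓ n) 𝒩) ∧
    ∀ 𝒩 : HomBundleMap (compactIdeal H),
      Induces (compactIdeal H) (rankOneOp ℓ n) 𝒩 →
        IsHomogeneousMap (compactIdeal H) 𝒩 ∧ ¬ 𝒩.IsNijenhuis := by
  have hN_apply : ∀ a, rankOneOp ℓ n a = ℓ a • n := fun _ => rfl
  have hN : ∀ a ∈ compactIdeal H, rankOneOp ℓ n a ∈ compactIdeal H := fun a ha => by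
    rw [hN_apply, hℓ a ha, zero_smul]
    exact zero_mem _
  have hH : ¬ FiniteDimensional ℂ H := fun _ => hn (isCompactOperator_of_finiteDimensional n)
  have hind := induces_conjBundleMap (compactIdeal H) (rankOneOp ℓ n) hN
  refine ⟨isAdmissible_of_map_mem _ _ hN, ⟨_, hind, fun 𝒩 h => h.unique _ hind⟩, fun 𝒩 h => ?_⟩
  obtain rfl := h.unique _ hind
  refine ⟨isHomogeneousMap_conjBundleMap _ _, fun hNij => ?_⟩
  have key : ∀ a b, ℓ a * ℓ (n * b - b * n) + ℓ b * ℓ (a * n - n * a)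
      = ℓ (a * b - b * a) * ℓ n := fun a b => by
    have h1 := hℓ _ (mem_of_isNijenhuis (compactIdeal H) _ hN hNij a b)
    simp only [hN_apply, map_sub, map_add, map_smul, smul_mul_assoc, mul_smul_comm, smul_eq_mul]
      at h1 ⊢
    refine mul_right_cancel₀ hℓn ?_
    linear_combination h1
  have hn_comm : ∀ b, ℓ (n * b - b * n) = 0 := fun b => by
    simpa [hℓ_one] using key 1 b
  have hcomm : ∀ a b, ℓ (a * b) = ℓ (b * a) := fun a b => by
    have h1 := key a b
    rw [hn_comm b, ← neg_sub, map_neg, hn_comm a] at h1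
    have h2 : ℓ (a * b - b * a) = 0 := by simpa [hℓn] using h1
    exact sub_eq_zero.1 ((map_sub ℓ _ _).symm.trans h2)
  exact one_ne_zero (hℓ_one.symm.trans (map_one_eq_zero_of_forall_map_mul_comm hH ℓ hcomm))
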